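/- **Setting.** Let $Z_1,\dots,Z_D\subset\mathbb R$ be measurable, $Z=Z_1\times\dots\times Z_D$, and let $p$ be a probability density on $Z$. For $S\subset\{1,\dots,D\}$ write $z^S$ for the sub-vector of $z$ with indices in $S$, $Z^S=\prod_{i\in S}Z_i$, and let $p_S(u)=\int_{Z^{S^c}}p$ be the marginal density. Let $G$ be an acyclic directed mixed graph on $\{1,\dots,D\}$ for which the natural order is topological. The Markov pillow $\mathrm{mp}(j)\subset\{1,\dots,j-1\}$ consists of the vertices other than $j$ that, in the subgraph of $G$ on $\{1,\dots,j\}$, are joined to $j$ by a bi-directed path or are parents of $j$ or of such a vertex. Put $p_{j|\mathrm{mp}(j)}(t|u)=p_{j,\mathrm{mp}(j)}(t,u)/p_{\mathrm{mp}(j)}(u)$ and assume $p(z)=\prod_{j=1}^D p_{j|\mathrm{mp}(j)}(z^j|z^{\mathrm{mp}(j)})$ for almost every $z\in Z$. Let $F$ be a hypothesis class, $\ell:F\times\mathbb R^D\to\mathbb R$ a loss, $\ell_f=\ell(f,\cdot)$, $L_F=\{\ell_f:f\in F\}$. For each $j$ let $K^j:\mathbb R^{|\mathrm{mp}(j)|}\to\mathbb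 R$ be a kernel (with $K^j=1$ if $\mathrm{mp}(j)=\emptyset$), let $h_1,\dots,h_D>0$, let $H_j$ be the diagonal matrix with entries $h_i$, $i\in\mathrm{mp}(j)$, and $K^j_H(u)=|\det H_j|^{-1}K^j(H_j^{-1}u)$. Define $$\ell_{f,j}(z^1,\dots,z^j)=\int_{Z_{j+1}\times\dots\times Z_D}\ell_f(z)\prod_{k>j}p_{k|\mathrm{mp}(k)}(z^k|z^{\mathrm{mp}(k)})\,dz^{j+1}\cdots dz^D,$$ $$L_F^j=\{\ell_{f,j}(z^1,\dots,z^{j-1},\cdot):f\in F,\ z^i\in Z_i\},\qquad \mathcal K_H^j=\{K_H^j(u-\cdot):u\in Z^{\mathrm{mp}(j)}\}.$$ For a class $\mathcal F$ of real functions on $Z$ let $$\mathfrak R_n(\mathcal F)=\mathbb E\Big[\sup_{\varphi\in\mathcal F}\Big|\tfrac1n\sum_{i=1}^n\sigma_i\varphi(X_i)\Big|\Big],$$ with $X_i$ i.i.d. of density $p$ and $\sigma_i$ independent uniform signs, independent of the $X_i$. Put $B_\ell=\sup_{f}\sup_{z\in\mathbb R^D}|\ell_f(z)|$, $$R_{F,K}=\sum_{j=1}^D|\det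 H_j|\,\mathfrak R_n(L_F^j\otimes\mathcal K_H^j),\qquad R_K=\sum_{j=1}^D|\det H_j|\,\mathfrak R_n(\mathcal K_H^j),$$ where $L_F^j\otimes\mathcal K_H^j$ consists of the functions $z\mapsto g(z^j)k(z^{\mathrm{mp}(j)})$ with $g\in L_F^j$, $k\in\mathcal K_H^j$, and $k\in\mathcal K_H^j$ is regarded as the function $z\mapsto k(z^{\mathrm{mp}(j)})$. **Boundedness assumptions.** $B_\ell<\infty$; each $K^j$ is bounded, continuous and strictly positive; each $Z_j$ is compact; $p_{\mathrm{mp}(j)}$ is bounded away from zero on $Z^{\mathrm{mp}(j)}$; and $\sup\{|K^j_H(u-v)|:u\in Z^{\mathrm{mp}(j)},v\notin Z^{\mathrm{mp}(j)}\}<\infty$. **Smoothness assumptions.** Let $\beta>1$, $L>0$, $k=\lfloor\beta\rfloor$, and let $\Sigma(\beta,L)$ be the class of $k$ times continuously differentiable functions $f$ on Euclidean space with $|D^\alpha f(x)-D^\alpha f(x')|\le L\|x-x'\|^{\beta-k}$ for all $|\alpha|=k$ and all $x,x'$. For every $j$: $p_{\mathrm{mp}(j)}$ has an extension in $\Sigma(\beta,L)$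 that is absolutely integrable off $Z^{\mathrm{mp}(j)}$; for every $t\in Z_j$, $p_{j,\mathrm{mp}(j)}(t,\cdot)$ has an extension $\check p_j(t,\cdot)\in\Sigma(\beta,L)$, with $\int_{Z_j}\int_{\mathbb R^{|\mathrm{mp}(j)|}\setminus Z^{\mathrm{mp}(j)}}|\check p_j(t,u)|\,du\,dt<\infty$; and $\int K^j=1$, $\int K^j(u)u^\alpha du=0$ for $1\le|\alpha|\le k$, $\int|K^j(u)|\,\|u\|^\beta du<\infty$. **Complexity assumptions.** The functions in $L_F$ are Lipschitz with a common constant; each $K^j$ is Lipschitz; for each $k$ the functions $p_{k|\mathrm{mp}(k)}(t|\cdot)$, $t\in Z_k$, are Lipschitz on $Z^{\mathrm{mp}(k)}$ with a common constant; and $h_1=\dots=h_D$. **Proposition (Comparison of the complexity measures).** Under these assumptions there are constants $C,C'$ such that for every $n\ge1$ $$\mathfrak R_n(L_F)\le C\,n^{-1/(D+2)},\qquad R_{F,K}+B_\ell R_K\le C'\,n^{-1/3}.$$ Here the problem data (including the bandwidth) are fixed and the constants do not depend on $n$. -/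

import Mathlib

open MeasureTheory Set
open scoped ENNReal NNReal

noncomputable section

namespace ADMGAug

/-! ## Acyclic directed mixed graphs and Markov pillows -/

/-- An acyclic directed mixed graph on the vertex set `V`. The bi-directed edges form a symmetric
irreflexive relation, i.e. a simple graph. -/
structure ADMG (V : Type*) where
  dir : V → V → Prop
  bidir : SimpleGraph V
  acyclic : ∀ v, ¬ Relation.TransGen dir v v

namespace ADMG

variable {V : Type*}

/-- The subgraph on the vertices in `A` (the other vertices are kept, without any edge). -/
def restrict (G : ADMG V) (A : Set V) : ADMG V where
  dir a b := G.dir a b ∧ a ∈ A ∧ b ∈ A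
  bidir :=
    { Adj := fun a b => G.bidir.Adj a b ∧ a ∈ A ∧ b ∈ A
      symm := ⟨fun _ _ h => ⟨h.1.symm, h.2.2, h.2.1⟩⟩
      loopless := ⟨fun a h => G.bidir.loopless.irrefl a h.1⟩ }
  acyclic v h := G.acyclic v (Relation.TransGen.mono (fun _ _ hab => hab.1) _ _ h)

/-- The district of `v`: the vertices connected to `v` by a bi-directed path (`v` included). -/
def district (G : ADMG V) (v : V) : Set V := {w | G.bidir.Reachable v w}

/-- The parents of a set `A` of vertices. -/
def parents (G : ADMG V) (A : Set V) : Set V := {a | ∃ b ∈ A, G.dir a b} \ A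

/-- The order of `Fin D` is a topological order of `G`: for `i < j` there is no directed path from
`j` to `i`. -/
def IsTopological {D : ℕ} (G : ADMG (Fin D)) : Prop :=
  ∀ i j : Fin D, i < j → ¬ Relation.TransGen G.dir j i

/-- The Markov pillow of `j`: its district and the parents of its district, `j` itself removed,
everything taken in the subgraph on the vertices that precede `j` (including `j`). -/
def markovPillow {D : ℕ} (G : ADMG (Fin D)) (j : Fin D) : Finset (Fin D) :=
  (Set.toFinite (((G.restrict (Iic j)).district j ∪
    (G.restrict (Iic j)).parents ((G.restrict (Iic j)).district j)) \ {j})).toFinset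

end ADMG

/-! ## Rademacher complexity -/

/-- Rademacher complexity of the function class `𝓕`:
`E_{X ∼ q^m} E_σ sup_{f ∈ 𝓕} |m⁻¹ ∑ i, σ i * f (X i)|` with `σ` uniform on `{-1, 1}^m`. -/
def rademacher {𝒳 : Type*} [MeasurableSpace 𝒳] (m : ℕ) (q : Measure 𝒳) (𝓕 : Set (𝒳 → ℝ)) :
    ℝ≥0∞ :=
  ∫⁻ x : Fin m → 𝒳,
    (∑ σ : Fin m → ℤˣ, ⨆ f ∈ 𝓕, ‖(m : ℝ)⁻¹ * ∑ i, ((σ i : ℤ) : ℝ) * f (x i)‖ₑ) / 2 ^ m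
    ∂(Measure.pi fun _ => q)

/-! ## Sub-vectors, product sets, marginal and conditional densities -/

section Vectors

variable {D : ℕ}

/-- The product set `∏ i, Z i` in `ℝ^ι`. -/
def box {ι : Type*} (Z : ι → Set ℝ) : Set (EuclideanSpace ℝ ι) := {z | ∀ i, z i ∈ Z i}

/-- The sub-vector of `z` with indices in `S`. -/
def sub (S : Finset (Fin D)) (z : EuclideanSpace ℝ (Fin D)) : EuclideanSpace ℝ S :=
  WithLp.toLp 2 fun i => z i

/-- The vector with sub-vectors `u` on `S` and `y` on the complement of `S`. -/
def glue (S : Finset (Fin D)) (u : EuclideanSpace ℝ S) (y : EuclideanSpace ℝ ↥(Sᶜ)) :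
    EuclideanSpace ℝ (Fin D) :=
  WithLp.toLp 2 fun i => if h : i ∈ S then u ⟨i, h⟩ else y ⟨i, Finset.mem_compl.2 h⟩

/-- The vector on `insert j S` with `j`-th coordinate `t` and the other coordinates from `u`. -/
def adjoin (S : Finset (Fin D)) (j : Fin D) (t : ℝ) (u : EuclideanSpace ℝ S) :
    EuclideanSpace ℝ ↥(insert j S) :=
  WithLp.toLp 2 fun i =>
    if h : i.1 = j then t else u ⟨i.1, Finset.mem_of_mem_insert_of_ne i.2 h⟩

/-- The marginal density on the coordinates in `S` of a density `p` on `box Z`. -/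
def marginal (Z : Fin D → Set ℝ) (p : EuclideanSpace ℝ (Fin D) → ℝ) (S : Finset (Fin D))
    (u : EuclideanSpace ℝ S) : ℝ :=
  ∫ y in box (fun i : ↥(Sᶜ) => Z i), p (glue S u y)

/-- The joint density of the `j`-th coordinate and the coordinates in `S` (used for `j ∉ S`). -/
def jointDensity (Z : Fin D → Set ℝ) (p : EuclideanSpace ℝ (Fin D) → ℝ) (S : Finset (Fin D))
    (j : Fin D) (t : ℝ) (u : EuclideanSpace ℝ S) : ℝ :=
  marginal Z p (insert j S) (adjoin S j t u)

/-- The conditional density of the `j`-th coordinate given the coordinates in `S`. -/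
def condDensity (Z : Fin D → Set ℝ) (p : EuclideanSpace ℝ (Fin D) → ℝ) (S : Finset (Fin D))
    (j : Fin D) (t : ℝ) (u : EuclideanSpace ℝ S) : ℝ :=
  jointDensity Z p S j t u / marginal Z p S u

end Vectors

/-! ## Hölder class -/

/-- The `(β, L)`-Hölder class on `ℝ^ι`: the `⌊β⌋`-times continuously differentiable functions all
of whose partial derivatives of order `⌊β⌋` are `(β - ⌊β⌋)`-Hölder with constant `L`. A partial
derivative of order `k` is the `k`-th derivative evaluated at a `k`-tuple of basis vectors. -/
def HolderClass {ι : Type*} [Fintype ι] [DecidableEq ι] (β L : ℝ) :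
    Set (EuclideanSpace ℝ ι → ℝ) :=
  {f | ContDiff ℝ (⌊β⌋₊ : ℕ) f ∧
    ∀ (a : Fin ⌊β⌋₊ → ι) (x x' : EuclideanSpace ℝ ι),
      |iteratedFDeriv ℝ ⌊β⌋₊ f x (fun i => EuclideanSpace.single (a i) (1 : ℝ)) -
        iteratedFDeriv ℝ ⌊β⌋₊ f x' (fun i => EuclideanSpace.single (a i) (1 : ℝ))| ≤
      L * ‖x - x'‖ ^ (β - (⌊β⌋₊ : ℝ))}

/-! ## The learning problem -/

/-- The data of the learning problem with hypothesis class `F`, and the standing assumptions. -/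
structure Setup (D : ℕ) (F : Type*) where
  /-- the mixed graph -/
  G : ADMG (Fin D)
  topological : G.IsTopological
  /-- the ranges of the variables -/
  Z : Fin D → Set ℝ
  measurableSet_Z : ∀ j, MeasurableSet (Z j)
  /-- the joint density on `box Z` -/
  p : EuclideanSpace ℝ (Fin D) → ℝ
  measurable_p : Measurable p
  p_nonneg : ∀ z, 0 ≤ p z
  lintegral_p : ∫⁻ z in box Z, ENNReal.ofReal (p z) = 1
  /-- topological ADMG factorization -/
  factorization : ∀ᵐ z ∂(volume.restrict (box Z)),
    p z = ∏ j, condDensity Z p (G.markovPillow j) j (z j) (sub (G.markovPillow j) z)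
  /-- the loss function -/
  loss : F → EuclideanSpace ℝ (Fin D) → ℝ
  /-- the kernel functions -/
  K : ∀ j, EuclideanSpace ℝ (G.markovPillow j) → ℝ
  K_eq_one : ∀ j, G.markovPillow j = ∅ → ∀ u, K j u = 1
  /-- the bandwidths -/
  h : Fin D → ℝ
  h_pos : ∀ j, 0 < h j

namespace Setup

variable {D : ℕ} {F : Type*} (M : Setup D F)

/-- The Markov pillow of `j`. -/
abbrev mp (j : Fin D) : Finset (Fin D) := M.G.markovPillow j

/-- The distribution of the data. -/
def law : Measure (EuclideanSpace ℝ (Fin D)) :=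
  (volume.restrict (box M.Z)).withDensity fun z => ENNReal.ofReal (M.p z)

/-- The range of the sub-vector of the variables in the Markov pillow of `j`. -/
def Zmp (j : Fin D) : Set (EuclideanSpace ℝ (M.mp j)) := box fun i : M.mp j => M.Z i

/-- The marginal density of the variables in the Markov pillow of `j`. -/
def pmp (j : Fin D) (u : EuclideanSpace ℝ (M.mp j)) : ℝ := marginal M.Z M.p (M.mp j) u

/-- The joint density of the `j`-th variable and those in its Markov pillow. -/
def pjmp (j : Fin D) (t : ℝ) (u : EuclideanSpace ℝ (M.mp j)) : ℝ :=
  jointDensity M.Z M.p (M.mp j) j t u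

/-- The conditional density of the `j`-th variable given those in its Markov pillow. -/
def pcond (j : Fin D) (t : ℝ) (u : EuclideanSpace ℝ (M.mp j)) : ℝ :=
  condDensity M.Z M.p (M.mp j) j t u

/-- The loss class `{ℓ(f, ·) : f ∈ F}`. -/
def lossClass : Set (EuclideanSpace ℝ (Fin D) → ℝ) := range M.loss

/-- The bound `sup_f sup_z |ℓ(f, z)|` of the loss function. -/
def lossBound : ℝ≥0∞ := ⨆ f, ⨆ z, ‖M.loss f z‖ₑ

/-- The bandwidth matrix of the `j`-th kernel. -/
def H (j : Fin D) : Matrix (M.mp j) (M.mp j) ℝ := Matrix.diagonal fun i => M.h i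

/-- The scaled kernel `u ↦ |det H_j|⁻¹ K^j(H_j⁻¹ u)`. -/
def KH (j : Fin D) (u : EuclideanSpace ℝ (M.mp j)) : ℝ :=
  |(M.H j).det|⁻¹ * M.K j (WithLp.toLp 2 (((M.H j)⁻¹).mulVec u.ofLp))

/-- The marginalized loss: `ℓ(f, z)` integrated over `z^{j+1}, …, z^D` against the product of the
conditional densities of these variables. -/
def margLoss (f : F) (j : Fin D) (x : EuclideanSpace ℝ (Finset.Iic j)) : ℝ :=
  ∫ y in box (fun i : ↥((Finset.Iic j)ᶜ) => M.Z i),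
    M.loss f (glue (Finset.Iic j) x y) *
      ∏ k ∈ Finset.Ioi j, M.pcond k (glue (Finset.Iic j) x y k)
        (sub (M.mp k) (glue (Finset.Iic j) x y))

/-- The vector `(z^1, …, z^{j-1}, t)`. -/
def extend (j : Fin D) (x : EuclideanSpace ℝ (Finset.Iio j)) (t : ℝ) :
    EuclideanSpace ℝ (Finset.Iic j) :=
  WithLp.toLp 2 fun i => if h : i.1 < j then x ⟨i.1, Finset.mem_Iio.2 h⟩ else t

/-- The class of univariate functions `ℓ_{f,j}(z^1, …, z^{j-1}, ·)`. -/
def margLossClass (j : Fin D) : Set (ℝ → ℝ) :=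
  {g | ∃ f : F, ∃ x ∈ box (fun i : Finset.Iio j => M.Z i),
    g = fun t => M.margLoss f j (extend j x t)}

/-- The class of shifted kernels `K^j_H(z - ·)` with `z` in the range of the pillow variables. -/
def kernelClass (j : Fin D) : Set (EuclideanSpace ℝ (M.mp j) → ℝ) :=
  {k | ∃ z ∈ M.Zmp j, k = fun v => M.KH j (z - v)}

/-- The shifted kernels as functions of the whole data vector. -/
def liftedKernelClass (j : Fin D) : Set (EuclideanSpace ℝ (Fin D) → ℝ) :=
  {φ | ∃ k ∈ M.kernelClass j, φ = fun z => k (sub (M.mp j) z)}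

/-- The products of a marginalized loss function of the `j`-th variable and a shifted kernel of the
variables in the Markov pillow of `j`, as functions of the whole data vector. -/
def productClass (j : Fin D) : Set (EuclideanSpace ℝ (Fin D) → ℝ) :=
  {φ | ∃ g ∈ M.margLossClass j, ∃ k ∈ M.kernelClass j, φ = fun z => g (z j) * k (sub (M.mp j) z)}

/-- `R_{F,K}` at sample size `n`. -/
def hypothesisComplexity (n : ℕ) : ℝ≥0∞ :=
  ∑ j, ENNReal.ofReal |(M.H j).det| * rademacher n M.law (M.productClass j)

/-- `R_K` at sample size `n`. -/
def kernelComplexity (n : ℕ) : ℝ≥0∞ :=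
  ∑ j, ENNReal.ofReal |(M.H j).det| * rademacher n M.law (M.liftedKernelClass j)

/-- Boundedness assumptions. -/
structure Bounded : Prop where
  loss : M.lossBound < ⊤
  kernel : ∀ j, ⨆ u, ‖M.K j u‖ₑ < ⊤
  compact : ∀ j, IsCompact (M.Z j)
  density : ∀ j, ∃ ε > 0, ∀ u ∈ M.Zmp j, ε ≤ M.pmp j u
  kernel_continuous : ∀ j, Continuous (M.K j)
  kernel_pos : ∀ j u, 0 < M.K j u
  kernel_off : ∀ j, ⨆ u ∈ M.Zmp j, ⨆ v ∈ (M.Zmp j)ᶜ, ‖M.KH j (u - v)‖ₑ < ⊤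

/-- Smoothness assumptions. -/
structure Smooth (β L : ℝ) : Prop where
  marginal : ∀ j, ∃ q ∈ HolderClass (ι := M.mp j) β L,
    EqOn q (M.pmp j) (M.Zmp j) ∧ ∫⁻ u in (M.Zmp j)ᶜ, ‖q u‖ₑ < ⊤
  joint : ∀ j, ∃ q : ℝ → EuclideanSpace ℝ (M.mp j) → ℝ,
    (∀ t ∈ M.Z j, q t ∈ HolderClass (ι := M.mp j) β L ∧ EqOn (q t) (M.pjmp j t) (M.Zmp j)) ∧
      ∫⁻ t in M.Z j, ∫⁻ u in (M.Zmp j)ᶜ, ‖q t u‖ₑ < ⊤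
  kernel_integral : ∀ j, ∫ u, M.K j u = 1
  kernel_moment : ∀ j, ∀ α : M.mp j → ℕ, 1 ≤ ∑ i, α i → ∑ i, α i ≤ ⌊β⌋₊ →
    ∫ u, M.K j u * ∏ i, u i ^ α i = 0
  kernel_integrable : ∀ j, Integrable fun u => |M.K j u| * ‖u‖ ^ β

/-- Lipschitz assumptions on the losses, the kernels and the conditional densities, together with
an isotropic bandwidth. -/
structure LipschitzIsotropic : Prop where
  loss : ∃ C : ℝ≥0, ∀ f, LipschitzWith C (M.loss f)
  kernel : ∀ j, ∃ C : ℝ≥0, LipschitzWith C (M.K j)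
  density : ∀ k, ∃ C : ℝ≥0, ∀ t ∈ M.Z k, LipschitzOnWith C (M.pcond k t) (M.Zmp k)
  isotropic : ∃ c, ∀ j, M.h j = c

end Setup

end ADMGAug

end

open MeasureTheory Set
open scoped ENNReal NNReal

noncomputable section

namespace ADMGAug

/-! ## Rademacher averages of finitely many vectors -/

/-! Both rates come from a single-scale discretization followed by a finite-class bound. If, up to a
uniform error `ε`, every member of a class is `a (cell x) * k j x` with `|a| ≤ 1` and `j` in a
finite set `J`, then for fixed signs the supremum over `a` is that of a linear functional on a cube,
so it is attained at a vertex. Only `2 ^ #cells * #J` vectors matter, and Massart's lemma gives `ε +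
2 b √(L / n)` with `L` at least the logarithm of that number (`rademacher_le_of_approx`).

The losses are uniformly Lipschitz on a bounded box of dimension `D`. A grid with `m` intervals per
axis has `m ^ D` cells and error of order `1 / m`, and `1 / m + √(m ^ D / n)` is balanced by `m ≈ n
^ (1 / (D + 2))` (`exists_rate_bound`).

A function in the product class is a univariate Lipschitz function times a kernel indexed by a shift
in a bounded box of dimension `d`. The univariate factor needs `m` cells. The shifts need `m ^ d`
grid points, but these enter only through `d log m ≤ d m`. The balance is therefore the
one-dimensional `1 / m + √(m / n)`, whence the exponent `1 / 3` whatever `D` is.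

It remains to see that the marginalized losses are bounded and Lipschitz in their last variable
(`exists_margLoss_bound`). The conditional densities may be unbounded in their own variable, but
being Lipschitz in the pillow variables they lie below an envelope integrable in their own variable
(`exists_pcond_envelope`), and this passes the Lipschitz bound through the integral. -/

lemma sum_signs_exp {n : ℕ} (v : Fin n → ℝ) :
    ∑ σ : Fin n → ℤˣ, Real.exp (∑ i, ((σ i : ℤ) : ℝ) * v i) = ∏ i, (2 * Real.cosh (v i)) := by
  have h (i : Fin n) : 2 * Real.cosh (v i) = ∑ s : ℤˣ, Real.exp (((s : ℤ) : ℝ) * v i) := by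
    rw [Real.cosh_eq, UnitsInt.univ, Finset.sum_pair (by decide)]
    simp
    ring
  simp_rw [h, Real.exp_sum]
  rw [Finset.prod_univ_sum, Fintype.piFinset_univ]

lemma sum_signs_exp_le {n : ℕ} (v : Fin n → ℝ) {c : ℝ} (hv : ∀ i, |v i| ≤ c) :
    ∑ σ : Fin n → ℤˣ, Real.exp (∑ i, ((σ i : ℤ) : ℝ) * v i) ≤
      2 ^ n * Real.exp (n * c ^ 2 / 2) := by
  rw [sum_signs_exp]
  calc ∏ i, (2 * Real.cosh (v i)) ≤ ∏ _i : Fin n, (2 * Real.exp (c ^ 2 / 2)) := by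
        refine Finset.prod_le_prod (fun i _ => by positivity) fun i _ => ?_
        have h1 := Real.cosh_le_exp_half_sq (v i)
        have h2 : Real.exp (v i ^ 2 / 2) ≤ Real.exp (c ^ 2 / 2) := by
          have := sq_le_sq' (neg_le_of_abs_le (hv i)) (le_of_abs_le (hv i))
          gcongr
        linarith
    _ = 2 ^ n * Real.exp (n * c ^ 2 / 2) := by
        rw [Finset.prod_const, mul_pow, ← Real.exp_nat_mul]
        simp
        ring_nf

/-- Massart's finite class lemma, with a non-optimal constant. -/
lemma massart {T : Type*} [Fintype T] {n : ℕ} (hn : 1 ≤ n) (v : T → Fin n → ℝ) {b L : ℝ}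
    (hb : 0 < b) (hL : 0 < L) (hT : (Fintype.card T : ℝ) ≤ Real.exp L)
    (hv : ∀ t i, |v t i| ≤ b) (m : (Fin n → ℤˣ) → ℝ)
    (hm : ∀ σ, ∃ t, m σ ≤ ∑ i, ((σ i : ℤ) : ℝ) * v t i) :
    ∑ σ, m σ ≤ 2 ^ n * (2 * b * √(n * L)) := by
  have hn' : (0 : ℝ) < n := by exact_mod_cast hn
  set s := √(n * L) with hs
  have hs0 : 0 < s := Real.sqrt_pos.2 (by positivity)
  have hs2 : s ^ 2 = n * L := Real.sq_sqrt (by positivity)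
  -- This is `√(L / n) / b`, which makes the exponent `n (r b) ^ 2 / 2` equal to `L / 2`.
  set r := L / (b * s) with hr
  have hr0 : 0 < r := by positivity
  have hrb : n * (r * b) ^ 2 / 2 = L / 2 := by
    have : r * b = L / s := by rw [hr]; field_simp
    rw [this, div_pow, hs2]
    field_simp
  have h1 (σ : Fin n → ℤˣ) : r * m σ ≤ (3 / 2 * L - 1) +
      Real.exp (-(3 / 2 * L)) * ∑ t, Real.exp (∑ i, ((σ i : ℤ) : ℝ) * (r * v t i)) := by
    obtain ⟨t, ht⟩ := hm σ
    -- The tangent line of `exp` at `3 L / 2` replaces Jensen's inequality: the average of `exp (r *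
    -- m σ)` is at most `exp L * exp (L / 2)`.
    have h2 := Real.add_one_le_exp (r * m σ - 3 / 2 * L)
    rw [sub_eq_neg_add, Real.exp_add] at h2
    have h3 : Real.exp (r * m σ) ≤ ∑ t, Real.exp (∑ i, ((σ i : ℤ) : ℝ) * (r * v t i)) := by
      refine le_trans (Real.exp_le_exp.2 ?_) (Finset.single_le_sum
        (f := fun t => Real.exp (∑ i, ((σ i : ℤ) : ℝ) * (r * v t i)))
        (fun _ _ => (Real.exp_pos _).le) (Finset.mem_univ t))
      have := mul_le_mul_of_nonneg_left ht hr0.le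
      rw [Finset.mul_sum] at this
      refine this.trans (le_of_eq (Finset.sum_congr rfl fun i _ => by ring))
    have := mul_le_mul_of_nonneg_left h3 (Real.exp_pos (-(3 / 2 * L))).le
    linarith
  have h4 : r * ∑ σ, m σ ≤ 2 ^ n * (3 / 2 * L) := by
    rw [Finset.mul_sum]
    refine (Finset.sum_le_sum fun σ _ => h1 σ).trans ?_
    rw [Finset.sum_add_distrib, ← Finset.mul_sum, Finset.sum_comm]
    have h5 : ∑ t, ∑ σ : Fin n → ℤˣ, Real.exp (∑ i, ((σ i : ℤ) : ℝ) * (r * v t i)) ≤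
        Real.exp L * (2 ^ n * Real.exp (L / 2)) := by
      have h6 (t : T) := sum_signs_exp_le (fun i => r * v t i) (c := r * b) fun i => by
        rw [abs_mul, abs_of_pos hr0]
        exact mul_le_mul_of_nonneg_left (hv t i) hr0.le
      refine (Finset.sum_le_sum fun t _ => h6 t).trans ?_
      rw [hrb, Finset.sum_const, nsmul_eq_mul, Finset.card_univ]
      gcongr
    have h7 : Real.exp (-(3 / 2 * L)) * (Real.exp L * (2 ^ n * Real.exp (L / 2))) = 2 ^ n := by
      rw [mul_left_comm _ ((2 : ℝ) ^ n), mul_left_comm _ ((2 : ℝ) ^ n), ← Real.exp_add,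
        ← Real.exp_add]
      ring_nf
      simp
    have h8 := mul_le_mul_of_nonneg_left h5 (Real.exp_pos (-(3 / 2 * L))).le
    have h9 : ∑ _σ : Fin n → ℤˣ, (3 / 2 * L - 1) = 2 ^ n * (3 / 2 * L - 1) := by
      rw [Finset.sum_const, nsmul_eq_mul]
      simp [Fintype.card_units_int]
    rw [h9]
    linarith
  have h10 : ∑ σ, m σ ≤ 2 ^ n * (3 / 2 * L) / r := by
    rw [le_div_iff₀ hr0]
    linarith
  refine h10.trans (le_of_eq_of_le (b := 2 ^ n * (3 / 2 * b * s)) ?_ ?_)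
  · rw [hr]
    field_simp
  · gcongr
    norm_num

/-- A class that is, up to `ε`, made of products of a function that is constant on the cells of a
finite partition, and one of finitely many bounded functions. -/
lemma rademacher_le_of_approx {𝒳 ι J : Type*} [MeasurableSpace 𝒳] [Fintype ι] [Fintype J]
    [Nonempty J] {n : ℕ} (hn : 1 ≤ n) (q : Measure 𝒳) [IsProbabilityMeasure q]
    {𝓕 : Set (𝒳 → ℝ)} {X : Set 𝒳} (hX : ∀ᵐ x ∂q, x ∈ X) (cell : 𝒳 → ι) (k : J → 𝒳 → ℝ)
    {b L ε : ℝ} (hb : 0 < b) (hL : 0 < L) (hε : 0 ≤ ε)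
    (hcard : (2 : ℝ) ^ Fintype.card ι * Fintype.card J ≤ Real.exp L)
    (hk : ∀ j, ∀ x ∈ X, |k j x| ≤ b)
    (hF : ∀ f ∈ 𝓕, ∃ j, ∃ a : ι → ℝ, (∀ i, |a i| ≤ 1) ∧
      ∀ x ∈ X, |f x - a (cell x) * k j x| ≤ ε) :
    rademacher n q 𝓕 ≤ ENNReal.ofReal (ε + 2 * b * √(L / n)) := by
  classical
  have hn' : (0 : ℝ) < n := by exact_mod_cast hn
  have hall : ∀ᵐ x ∂(Measure.pi fun _ : Fin n => q), ∀ i, x i ∈ X :=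
    ae_all_iff.2 fun i => (Measure.quasiMeasurePreserving_eval (fun _ : Fin n => q) i).ae hX
  -- The bound holds for every sample with all points in `X`, so no measurability of the supremum is
  -- needed.
  refine (lintegral_mono_ae (g := fun _ => ENNReal.ofReal (ε + 2 * b * √(L / n))) ?_).trans
    (by simp)
  filter_upwards [hall] with x hx
  set S : (Fin n → ℤˣ) → J → ι → ℝ := fun σ j c =>
    ∑ i, if cell (x i) = c then ((σ i : ℤ) : ℝ) * k j (x i) else 0 with hS
  have hsum (σ : Fin n → ℤˣ) (j : J) (a : ι → ℝ) :
      ∑ i, ((σ i : ℤ) : ℝ) * (a (cell (x i)) * k j (x i)) = ∑ c, a c * S σ j c := by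
    simp only [hS, Finset.mul_sum, mul_ite, mul_zero]
    rw [Finset.sum_comm]
    refine Finset.sum_congr rfl fun i _ => ?_
    rw [Finset.sum_ite_eq]
    simp
    ring
  -- `∑ c, |S σ j c|` is the maximum of `∑ c, a c * S σ j c` over `|a c| ≤ 1`, attained when `a c`
  -- is the sign of `S σ j c`.
  set m : (Fin n → ℤˣ) → ℝ := fun σ =>
    Finset.univ.sup' Finset.univ_nonempty fun j => ∑ c, |S σ j c| with hm
  have hle (σ : Fin n → ℤˣ) (j : J) : ∑ c, |S σ j c| ≤ m σ :=
    Finset.le_sup' (fun j => ∑ c, |S σ j c|) (Finset.mem_univ j)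
  have hm0 (σ : Fin n → ℤˣ) : 0 ≤ m σ :=
    (Finset.sum_nonneg fun _ _ => abs_nonneg _).trans (hle σ (Classical.arbitrary J))
  have hmass : ∑ σ, m σ ≤ 2 ^ n * (2 * b * √(n * L)) := by
    refine massart (T := (ι → ℤˣ) × J) hn
      (fun t i => ((t.1 (cell (x i)) : ℤ) : ℝ) * k t.2 (x i)) hb hL ?_ ?_ m ?_
    · simpa [Fintype.card_units_int] using hcard
    · intro t i
      have : |((t.1 (cell (x i)) : ℤ) : ℝ)| = 1 := by
        rcases Int.units_eq_one_or (t.1 (cell (x i))) with h | h <;> simp [h]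
      rw [abs_mul, this, one_mul]
      exact hk _ _ (hx i)
    · intro σ
      obtain ⟨j, -, hj⟩ := Finset.exists_mem_eq_sup' Finset.univ_nonempty
        fun j => ∑ c, |S σ j c|
      have hs (c : ι) : ∃ s : ℤˣ, |S σ j c| = ((s : ℤ) : ℝ) * S σ j c := by
        rcases abs_choice (S σ j c) with h | h
        · exact ⟨1, by simp [h]⟩
        · exact ⟨-1, by simp [h]⟩
      choose s hs using hs
      refine ⟨(s, j), le_of_eq ?_⟩
      rw [hsum σ j fun c => ((s c : ℤ) : ℝ)]
      exact hj.trans (Finset.sum_congr rfl fun c _ => hs c)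
  have hsup (σ : Fin n → ℤˣ) :
      (⨆ f ∈ 𝓕, ‖(n : ℝ)⁻¹ * ∑ i, ((σ i : ℤ) : ℝ) * f (x i)‖ₑ) ≤
        ENNReal.ofReal (ε + (n : ℝ)⁻¹ * m σ) := by
    refine iSup₂_le fun f hf => ?_
    obtain ⟨j, a, ha, hfa⟩ := hF f hf
    rw [← ofReal_norm, Real.norm_eq_abs]
    refine ENNReal.ofReal_le_ofReal ?_
    have h1 : ∑ i, ((σ i : ℤ) : ℝ) * f (x i) =
        ∑ i, ((σ i : ℤ) : ℝ) * (f (x i) - a (cell (x i)) * k j (x i)) +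
          ∑ c, a c * S σ j c := by
      rw [← hsum, ← Finset.sum_add_distrib]
      exact Finset.sum_congr rfl fun i _ => by ring
    have h2 : |∑ i, ((σ i : ℤ) : ℝ) * (f (x i) - a (cell (x i)) * k j (x i))| ≤ n * ε := by
      refine (Finset.abs_sum_le_sum_abs _ _).trans
        ((Finset.sum_le_sum (g := fun _ => ε) fun i _ => ?_).trans (by simp))
      have : |((σ i : ℤ) : ℝ)| = 1 := by
        rcases Int.units_eq_one_or (σ i) with h | h <;> simp [h]
      rw [abs_mul, this, one_mul]
      exact hfa _ (hx i)
    have h3 : |∑ c, a c * S σ j c| ≤ m σ := by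
      refine (Finset.abs_sum_le_sum_abs _ _).trans
        ((Finset.sum_le_sum fun c _ => ?_).trans (hle σ j))
      rw [abs_mul]
      exact mul_le_of_le_one_left (abs_nonneg _) (ha c)
    rw [abs_mul, abs_of_pos (inv_pos.2 hn'), h1]
    calc (n : ℝ)⁻¹ * |_ + _| ≤ (n : ℝ)⁻¹ * (n * ε + m σ) := by
          gcongr
          exact (abs_add_le _ _).trans (add_le_add h2 h3)
      _ = ε + (n : ℝ)⁻¹ * m σ := by field_simp
  rw [ENNReal.div_le_iff (by simp) (by simp)]
  refine (Finset.sum_le_sum fun σ _ => hsup σ).trans ?_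
  have h2 : (2 : ℝ≥0∞) ^ n = ENNReal.ofReal (2 ^ n) := by
    rw [ENNReal.ofReal_pow (by norm_num)]
    simp
  have hpos (σ : Fin n → ℤˣ) : 0 ≤ (n : ℝ)⁻¹ * m σ := mul_nonneg (by positivity) (hm0 σ)
  rw [← ENNReal.ofReal_sum_of_nonneg fun σ _ => add_nonneg hε (hpos σ), h2,
    ← ENNReal.ofReal_mul (by positivity)]
  refine ENNReal.ofReal_le_ofReal ?_
  rw [Finset.sum_add_distrib, ← Finset.mul_sum]
  have h3 : ∑ _σ : Fin n → ℤˣ, ε = 2 ^ n * ε := by simp [Fintype.card_units_int]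
  have h4 : (n : ℝ)⁻¹ * √(n * L) = √(L / n) := by
    rw [eq_comm, Real.sqrt_eq_iff_mul_self_eq (by positivity) (by positivity)]
    rw [mul_mul_mul_comm, Real.mul_self_sqrt (by positivity)]
    field_simp
  have h5 := mul_le_mul_of_nonneg_left hmass (inv_pos.2 hn').le
  rw [h3, ← h4]
  linarith

/-! ## Quantization of bounded sets -/

/-- Dividing by `4 * R` rather than by the length `2 * R` keeps the rescaled point at most `1 / 2`,
so the endpoint `x = R` does not fall into an extra bin. -/
lemma exists_quantizer {R : ℝ} (hR : 0 < R) {m : ℕ} (hm : 1 ≤ m) :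
    ∃ c : ℝ → Fin m, ∀ x y, |x| ≤ R → |y| ≤ R → c x = c y → |x - y| ≤ 4 * R / m := by
  have hm' : (0 : ℝ) < m := by exact_mod_cast hm
  set g : ℝ → ℕ := fun x => ⌊(x + R) / (4 * R) * m⌋₊ with hg
  refine ⟨fun x => if h : g x < m then ⟨g x, h⟩ else ⟨0, hm⟩, fun x y hx hy hxy => ?_⟩
  have hlt (x : ℝ) (hx : |x| ≤ R) : 0 ≤ (x + R) / (4 * R) * m ∧ g x < m := by
    have h1 := abs_le.1 hx
    have h2 : 0 ≤ (x + R) / (4 * R) := div_nonneg (by linarith) (by positivity)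
    refine ⟨by positivity, (Nat.floor_lt (by positivity)).2 ?_⟩
    refine mul_lt_of_lt_one_left hm' ?_
    rw [div_lt_one (by positivity)]
    linarith
  obtain ⟨hx0, hx1⟩ := hlt x hx
  obtain ⟨hy0, hy1⟩ := hlt y hy
  simp only [hx1, hy1, dif_pos, Fin.mk.injEq] at hxy
  have h3 := Nat.floor_le hx0
  have h4 := Nat.floor_le hy0
  have h5 := Nat.lt_floor_add_one ((x + R) / (4 * R) * m)
  have h6 := Nat.lt_floor_add_one ((y + R) / (4 * R) * m)
  have h7 : ((⌊(x + R) / (4 * R) * m⌋₊ : ℕ) : ℝ) = ⌊(y + R) / (4 * R) * m⌋₊ := by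
    exact_mod_cast hxy
  have h8 : |(x - y) * (m / (4 * R))| ≤ 1 := by
    have : (x - y) * (m / (4 * R)) = (x + R) / (4 * R) * m - (y + R) / (4 * R) * m := by ring
    rw [this, abs_le]
    constructor <;> linarith
  rw [abs_mul, abs_of_pos (show (0 : ℝ) < m / (4 * R) by positivity)] at h8
  rw [le_div_iff₀ hm']
  have h9 : |x - y| * (m / (4 * R)) = |x - y| * m / (4 * R) := by ring
  rw [h9, div_le_one (by positivity)] at h8
  exact h8

lemma dist_le_card_mul {ι : Type*} [Fintype ι] (x y : EuclideanSpace ℝ ι) {δ : ℝ}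
    (hxy : ∀ i, |x i - y i| ≤ δ) : dist x y ≤ Fintype.card ι * δ := by
  rw [EuclideanSpace.dist_eq]
  calc √(∑ i, dist (x i) (y i) ^ 2) ≤ ∑ i, dist (x i) (y i) :=
        Real.sqrt_le_iff.2 ⟨Finset.sum_nonneg fun _ _ => dist_nonneg,
          Finset.sum_sq_le_sq_sum_of_nonneg fun _ _ => dist_nonneg⟩
    _ ≤ ∑ _i : ι, δ := Finset.sum_le_sum fun i _ => by rw [Real.dist_eq]; exact hxy i
    _ = Fintype.card ι * δ := by simp

/-! ## Choice of the resolution -/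

/-- Take `m = ⌈t⌉` with `t = n ^ (1 / (d + 2))`. Since `t ≥ 1`, rounding costs at most a factor `2`,
and `t ^ (d + 2) = n` makes both terms of order `1 / t`. -/
lemma exists_rate_bound (d : ℕ) {A : ℝ} (hA : 0 ≤ A) {r : ℕ → ℝ≥0∞}
    (hr : ∀ n, 1 ≤ n → ∀ m : ℕ, 1 ≤ m →
      r n ≤ ENNReal.ofReal (A / m + A * √((m : ℝ) ^ d / n))) :
    ∃ C : ℝ≥0, ∀ n : ℕ, 1 ≤ n → r n ≤ C * (n : ℝ≥0∞) ^ (-(1 / ((d : ℝ) + 2))) := by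
  refine ⟨Real.toNNReal (A + A * √(2 ^ d)), fun n hn => ?_⟩
  have hn' : (1 : ℝ) ≤ n := by exact_mod_cast hn
  have hn0 : (0 : ℝ) < n := by linarith
  set e : ℝ := 1 / ((d : ℝ) + 2) with he
  have he0 : 0 < e := by positivity
  set t : ℝ := (n : ℝ) ^ e with ht
  have ht1 : 1 ≤ t := Real.one_le_rpow hn' he0.le
  have ht0 : 0 < t := by linarith
  have htn : t ^ (d + 2) = n := by
    rw [ht, ← Real.rpow_natCast, ← Real.rpow_mul hn0.le, he]
    push_cast
    rw [one_div_mul_cancel (by positivity), Real.rpow_one]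
  have hm1 : 1 ≤ ⌈t⌉₊ := Nat.one_le_ceil_iff.2 ht0
  refine (hr n hn ⌈t⌉₊ hm1).trans ?_
  have hR : (n : ℝ≥0∞) ^ (-e) = ENNReal.ofReal t⁻¹ := by
    rw [ht, ← Real.rpow_neg hn0.le, ← ENNReal.ofReal_rpow_of_pos hn0, ENNReal.ofReal_natCast]
  rw [hR]
  change _ ≤ ENNReal.ofReal _ * _
  rw [← ENNReal.ofReal_mul (by positivity)]
  refine ENNReal.ofReal_le_ofReal ?_
  have hm2 : t ≤ ⌈t⌉₊ := Nat.le_ceil t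
  have hm3 : (⌈t⌉₊ : ℝ) ≤ 2 * t := by
    have := (Nat.ceil_lt_add_one ht0.le).le
    linarith
  have h1 : A / ⌈t⌉₊ ≤ A * t⁻¹ := by
    rw [← div_eq_mul_inv]
    gcongr
  have h2 : √((⌈t⌉₊ : ℝ) ^ d / n) ≤ √(2 ^ d) * t⁻¹ := by
    calc √((⌈t⌉₊ : ℝ) ^ d / n) ≤ √((2 * t) ^ d / t ^ (d + 2)) := by
          rw [htn]
          gcongr
      _ = √(2 ^ d * t⁻¹ ^ 2) := by
          congr 1
          rw [mul_pow, pow_add]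
          field_simp
      _ = √(2 ^ d) * t⁻¹ := by
          rw [Real.sqrt_mul (by positivity), Real.sqrt_sq (by positivity)]
  have h3 := mul_le_mul_of_nonneg_left h2 hA
  linarith

/-! ### Marginal and conditional densities -/

section Densities

variable {D : ℕ}

lemma measurableSet_box {ι : Type*} [Countable ι] {Z : ι → Set ℝ} (hZ : ∀ i, MeasurableSet (Z i)) :
    MeasurableSet (box Z) := by
  have : box Z = ⋂ i, (fun z : EuclideanSpace ℝ ι => z i) ⁻¹' Z i := by
    ext z
    simp [box]
  rw [this]
  exact MeasurableSet.iInter fun i => (by fun_prop : Measurable _) (hZ i)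

lemma measurable_glue (S : Finset (Fin D)) :
    Measurable fun w : EuclideanSpace ℝ S × EuclideanSpace ℝ ↥(Sᶜ) => glue S w.1 w.2 := by
  refine (WithLp.measurable_toLp 2 _).comp (measurable_pi_iff.2 fun i => ?_)
  by_cases h : i ∈ S
  · simp only [h, dif_pos]
    fun_prop
  · simp only [h, dif_neg, not_false_eq_true]
    fun_prop

lemma measurable_sub (S : Finset (Fin D)) : Measurable (sub S) :=
  (WithLp.measurable_toLp 2 _).comp (measurable_pi_iff.2 fun i => by fun_prop)

lemma measurable_adjoin (S : Finset (Fin D)) (j : Fin D) :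
    Measurable fun w : ℝ × EuclideanSpace ℝ S => adjoin S j w.1 w.2 := by
  refine (WithLp.measurable_toLp 2 _).comp (measurable_pi_iff.2 fun i => ?_)
  by_cases h : i.1 = j
  · simp only [h, dif_pos]
    fun_prop
  · simp only [h, dif_neg, not_false_eq_true]
    fun_prop

variable {Z : Fin D → Set ℝ} {p : EuclideanSpace ℝ (Fin D) → ℝ}

lemma measurable_marginal (hp : Measurable p) (S : Finset (Fin D)) :
    Measurable (marginal Z p S) :=
  (hp.comp (measurable_glue S)).stronglyMeasurable.integral_prod_right'.measurable

lemma marginal_nonneg (hp : ∀ z, 0 ≤ p z) (S : Finset (Fin D)) (u : EuclideanSpace ℝ S) :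
    0 ≤ marginal Z p S u :=
  integral_nonneg fun _ => hp _

lemma condDensity_nonneg (hp : ∀ z, 0 ≤ p z) (S : Finset (Fin D)) (j : Fin D) (t : ℝ)
    (u : EuclideanSpace ℝ S) : 0 ≤ condDensity Z p S j t u :=
  div_nonneg (marginal_nonneg hp _ _) (marginal_nonneg hp _ _)

lemma measurable_condDensity (hp : Measurable p) (S : Finset (Fin D)) (j : Fin D) :
    Measurable fun w : ℝ × EuclideanSpace ℝ S => condDensity Z p S j w.1 w.2 :=
  ((measurable_marginal hp _).comp (measurable_adjoin S j)).div
    ((measurable_marginal hp _).comp measurable_snd)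

/-- The vector on `Sᶜ` with `j`-th coordinate `t` and the other coordinates from `y`. -/
def adjoinCompl (S : Finset (Fin D)) (j : Fin D) (w : ℝ × EuclideanSpace ℝ ↥((insert j S)ᶜ)) :
    EuclideanSpace ℝ ↥(Sᶜ) :=
  WithLp.toLp 2 fun i => if h : i.1 = j then w.1 else
    w.2 ⟨i.1, Finset.mem_compl.2 fun hi =>
      (Finset.mem_insert.1 hi).elim h (Finset.mem_compl.1 i.2)⟩

lemma glue_adjoinCompl (S : Finset (Fin D)) (j : Fin D) (hj : j ∉ S) (u : EuclideanSpace ℝ S)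
    (w : ℝ × EuclideanSpace ℝ ↥((insert j S)ᶜ)) :
    glue S u (adjoinCompl S j w) = glue (insert j S) (adjoin S j w.1 u) w.2 := by
  ext i
  by_cases hi : i = j
  · subst hi
    simp [glue, adjoin, adjoinCompl, hj]
  · by_cases hS : i ∈ S <;> simp [glue, adjoin, adjoinCompl, hi, hS]

/-- Splits off one integration variable, so that Fubini applies to a marginal. A product measure is
determined by its values on boxes. -/
lemma measurePreserving_adjoinCompl (S : Finset (Fin D)) (j : Fin D) (hj : j ∉ S) :
    MeasurePreserving (adjoinCompl S j) := by
  set ψ : ℝ × (↥((insert j S)ᶜ) → ℝ) → (↥(Sᶜ) → ℝ) := fun w i =>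
    if h : i.1 = j then w.1 else
      w.2 ⟨i.1, Finset.mem_compl.2 fun hi =>
        (Finset.mem_insert.1 hi).elim h (Finset.mem_compl.1 i.2)⟩ with hψ
  have hψm : Measurable ψ := by
    refine measurable_pi_iff.2 fun i => ?_
    by_cases h : i.1 = j
    · simp only [hψ, h, dif_pos]
      fun_prop
    · simp only [hψ, h, dif_neg, not_false_eq_true]
      fun_prop
  have hψp : MeasurePreserving ψ := by
    refine ⟨hψm, (Measure.pi_eq fun s hs => ?_).symm⟩
    rw [Measure.map_apply hψm (MeasurableSet.univ_pi hs)]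
    have hmem (i : ↥((insert j S)ᶜ)) : i.1 ∈ Sᶜ :=
      Finset.mem_compl.2 fun h => Finset.mem_compl.1 i.2 (Finset.mem_insert_of_mem h)
    have hne (i : ↥((insert j S)ᶜ)) : i.1 ≠ j := fun h =>
      Finset.mem_compl.1 i.2 (Finset.mem_insert.2 (Or.inl h))
    have hpre : ψ ⁻¹' (univ.pi s) =
        s ⟨j, Finset.mem_compl.2 hj⟩ ×ˢ univ.pi fun i => s ⟨i.1, hmem i⟩ := by
      ext w
      simp only [mem_preimage, mem_univ_pi, mem_prod, hψ]
      constructor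
      · intro h
        refine ⟨by simpa using h ⟨j, Finset.mem_compl.2 hj⟩, fun i => ?_⟩
        simpa [hne i] using h ⟨i.1, hmem i⟩
      · rintro ⟨h1, h2⟩ ⟨i, hi⟩
        by_cases h : i = j
        · subst h
          simpa using h1
        · simpa [h] using h2 ⟨i, by simpa [h] using hi⟩
    rw [hpre, Measure.volume_eq_prod, Measure.prod_prod, volume_pi_pi]
    -- Side lengths indexed by all of `Fin D`, so that products over two different subtypes become
    -- comparable.
    set g : Fin D → ℝ≥0∞ := fun i => if h : i ∈ Sᶜ then volume (s ⟨i, h⟩) else 1 with hg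
    have h1 : ∏ i : ↥(Sᶜ), volume (s i) = ∏ i ∈ Sᶜ, g i := by
      rw [← Finset.prod_coe_sort Sᶜ g]
      exact Finset.prod_congr rfl fun i _ => by simp only [hg, i.2, dif_pos]
    have h2 : ∏ i : ↥((insert j S)ᶜ), volume (s ⟨i.1, hmem i⟩) = ∏ i ∈ (insert j S)ᶜ, g i := by
      rw [← Finset.prod_coe_sort (insert j S)ᶜ g]
      exact Finset.prod_congr rfl fun i _ => by simp only [hg, hmem i, dif_pos]
    have h3 : Sᶜ = insert j (insert j S)ᶜ := by
      ext i
      by_cases h : i = j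
      · subst h
        simp [hj]
      · simp [h]
    have h4 : volume (s ⟨j, Finset.mem_compl.2 hj⟩) = g j := by
      simp only [hg, Finset.mem_compl.2 hj, dif_pos]
    have h5 : ∏ i ∈ Sᶜ, g i = g j * ∏ i ∈ (insert j S)ᶜ, g i := by
      rw [h3, Finset.prod_insert (by simp)]
    rw [h1, h2, h4, h5]
  exact (PiLp.volume_preserving_toLp _).comp
    (hψp.comp ((MeasurePreserving.id volume).prod (PiLp.volume_preserving_ofLp _)))

/-- A nonzero marginal cannot be the default value of a non-integrable integral, so the slice of `p`
at `u` is integrable and Fubini applies. -/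
lemma integrableOn_jointDensity (hZ : ∀ i, MeasurableSet (Z i)) (S : Finset (Fin D)) (j : Fin D)
    (hj : j ∉ S) (u : EuclideanSpace ℝ S) (hu : 0 < marginal Z p S u) :
    IntegrableOn (fun t => jointDensity Z p S j t u) (Z j) := by
  have h1 : Integrable (fun y => p (glue S u y))
      (volume.restrict (box fun i : ↥(Sᶜ) => Z i)) := by
    by_contra h
    exact hu.ne' (integral_undef h)
  have hbox : adjoinCompl S j ⁻¹' (box fun i : ↥(Sᶜ) => Z i) =
      Z j ×ˢ box fun i : ↥((insert j S)ᶜ) => Z i := by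
    ext w
    simp only [mem_preimage, mem_prod, box, mem_ofPred_eq, adjoinCompl]
    constructor
    · intro h
      refine ⟨by simpa using h ⟨j, Finset.mem_compl.2 hj⟩, fun i => ?_⟩
      have hi := Finset.mem_compl.1 i.2
      have hne : i.1 ≠ j := fun h => hi (Finset.mem_insert.2 (Or.inl h))
      simpa [hne] using
        h ⟨i.1, Finset.mem_compl.2 fun h => hi (Finset.mem_insert_of_mem h)⟩
    · rintro ⟨h1, h2⟩ ⟨i, hi⟩
      by_cases h : i = j
      · subst h
        simpa using h1
      · simpa [h] using h2 ⟨i, by simpa [h] using hi⟩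
  have h2 := ((measurePreserving_adjoinCompl S j hj).restrict_preimage
    (measurableSet_box fun i : ↥(Sᶜ) => hZ i)).integrable_comp_of_integrable h1
  rw [hbox, Measure.volume_eq_prod, ← Measure.prod_restrict] at h2
  have h3 := h2.integral_prod_left
  simp only [Function.comp_def, glue_adjoinCompl S j hj] at h3
  exact h3

end Densities

lemma integrableOn_box_prod {ι : Type*} [Fintype ι] {Z : ι → Set ℝ}
    (hZ : ∀ i, MeasurableSet (Z i)) {q : ι → ℝ → ℝ} (hq : ∀ i, IntegrableOn (q i) (Z i)) :
    IntegrableOn (fun y : EuclideanSpace ℝ ι => ∏ i, q i (y i)) (box Z) := by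
  have h1 : Integrable (fun y : ι → ℝ => ∏ i, q i (y i))
      (volume.restrict (univ.pi Z)) := by
    rw [volume_pi, Measure.restrict_pi_pi]
    exact Integrable.fintype_prod hq
  have h2 := ((PiLp.volume_preserving_ofLp ι).restrict_preimage
    (MeasurableSet.univ_pi hZ)).integrable_comp_of_integrable h1
  have h3 : (WithLp.ofLp : EuclideanSpace ℝ ι → (ι → ℝ)) ⁻¹' univ.pi Z = box Z := by
    ext z
    simp [box]
  rw [h3] at h2
  exact h2

/-- Telescoping: exchange one factor at a time, bounding the other factors by `q`. -/
lemma abs_prod_sub_prod_le {ι : Type*} (s : Finset ι) (a b q : ι → ℝ) {δ : ℝ} (hδ : 0 ≤ δ)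
    (ha0 : ∀ i ∈ s, 0 ≤ a i) (hb0 : ∀ i ∈ s, 0 ≤ b i) (ha : ∀ i ∈ s, a i ≤ q i)
    (hb : ∀ i ∈ s, b i ≤ q i) (hab : ∀ i ∈ s, |a i - b i| ≤ δ * q i) :
    |∏ i ∈ s, a i - ∏ i ∈ s, b i| ≤ s.card * δ * ∏ i ∈ s, q i := by
  classical
  induction s using Finset.induction_on with
  | empty => simp
  | insert i s hi ih =>
    have ih := ih (fun k hk => ha0 k (Finset.mem_insert_of_mem hk))
      (fun k hk => hb0 k (Finset.mem_insert_of_mem hk))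
      (fun k hk => ha k (Finset.mem_insert_of_mem hk))
      (fun k hk => hb k (Finset.mem_insert_of_mem hk))
      (fun k hk => hab k (Finset.mem_insert_of_mem hk))
    have hi' := Finset.mem_insert_self i s
    have hbq : ∏ i ∈ s, b i ≤ ∏ i ∈ s, q i :=
      Finset.prod_le_prod (fun k hk => hb0 k (Finset.mem_insert_of_mem hk))
        (fun k hk => hb k (Finset.mem_insert_of_mem hk))
    have hbn : 0 ≤ ∏ i ∈ s, b i :=
      Finset.prod_nonneg fun k hk => hb0 k (Finset.mem_insert_of_mem hk)
    rw [Finset.prod_insert hi, Finset.prod_insert hi, Finset.prod_insert hi,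
      Finset.card_insert_of_notMem hi]
    have h1 : a i * ∏ i ∈ s, a i - b i * ∏ i ∈ s, b i =
        a i * (∏ i ∈ s, a i - ∏ i ∈ s, b i) + (a i - b i) * ∏ i ∈ s, b i := by ring
    have h2 : |a i * (∏ i ∈ s, a i - ∏ i ∈ s, b i)| ≤
        q i * (s.card * δ * ∏ i ∈ s, q i) := by
      rw [abs_mul, abs_of_nonneg (ha0 i hi')]
      exact mul_le_mul (ha i hi') ih (abs_nonneg _) ((ha0 i hi').trans (ha i hi'))
    have h3 : |(a i - b i) * ∏ i ∈ s, b i| ≤ δ * q i * ∏ i ∈ s, q i := by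
      rw [abs_mul, abs_of_nonneg hbn]
      exact mul_le_mul (hab i hi') hbq hbn
        (mul_nonneg hδ ((ha0 i hi').trans (ha i hi')))
    rw [h1]
    refine (abs_add_le _ _).trans ((add_le_add h2 h3).trans (le_of_eq ?_))
    push_cast
    ring

/-! ### Regularity of the marginalized losses -/

namespace Setup

variable {D : ℕ} {F : Type*} (M : Setup D F)

lemma notMem_mp (j : Fin D) : j ∉ M.mp j := by
  simp [mp, ADMG.markovPillow]

instance isProbabilityMeasure_law : IsProbabilityMeasure M.law := by
  refine ⟨?_⟩
  rw [law, withDensity_apply _ MeasurableSet.univ, Measure.restrict_univ]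
  exact M.lintegral_p

lemma ae_mem_box : ∀ᵐ z ∂M.law, z ∈ box M.Z :=
  (withDensity_absolutelyContinuous _ _).ae_le
    (ae_restrict_mem (measurableSet_box M.measurableSet_Z))

lemma exists_mem_box : ∃ z, z ∈ box M.Z := M.ae_mem_box.exists

lemma sub_mem_Zmp {z : EuclideanSpace ℝ (Fin D)} (hz : z ∈ box M.Z) (k : Fin D) :
    sub (M.mp k) z ∈ M.Zmp k := fun i => hz i

variable {M}

lemma Bounded.exists_abs_le (hB : M.Bounded) :
    ∃ R : ℝ, 0 < R ∧ ∀ i, ∀ x ∈ M.Z i, |x| ≤ R := by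
  choose R hR using fun i => (hB.compact i).isBounded.exists_norm_le
  refine ⟨1 + ∑ i, |R i|, by positivity, fun i x hx => ?_⟩
  have h1 := Finset.single_le_sum (f := fun i => |R i|) (fun _ _ => abs_nonneg _)
    (Finset.mem_univ i)
  have h2 := hR i x hx
  rw [Real.norm_eq_abs] at h2
  have h3 := le_abs_self (R i)
  linarith

lemma Bounded.abs_loss_le (hB : M.Bounded) (f : F) (z : EuclideanSpace ℝ (Fin D)) :
    |M.loss f z| ≤ M.lossBound.toReal := by
  rw [← Real.norm_eq_abs, ← toReal_enorm]
  exact ENNReal.toReal_mono hB.loss.ne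
    (le_iSup_of_le (f := fun f => ⨆ z, ‖M.loss f z‖ₑ) f (le_iSup (fun z => ‖M.loss f z‖ₑ) z))

lemma pcond_nonneg (k : Fin D) (t : ℝ) (u : EuclideanSpace ℝ (M.mp k)) : 0 ≤ M.pcond k t u :=
  condDensity_nonneg M.p_nonneg _ _ _ _

lemma LipschitzIsotropic.exists_pcond_lipschitz (hC : M.LipschitzIsotropic) :
    ∃ A : ℝ, 0 ≤ A ∧ ∀ k, ∀ t ∈ M.Z k, ∀ u ∈ M.Zmp k, ∀ v ∈ M.Zmp k,
      |M.pcond k t u - M.pcond k t v| ≤ A * dist u v := by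
  choose C hC using hC.density
  refine ⟨∑ k, (C k : ℝ), by positivity, fun k t ht u hu v hv => ?_⟩
  rw [← Real.dist_eq]
  refine ((hC k t ht).dist_le_mul u hu v hv).trans ?_
  gcongr
  exact Finset.single_le_sum (f := fun k => (C k : ℝ)) (fun _ _ => NNReal.coe_nonneg _)
    (Finset.mem_univ k)

/-- The value at one fixed pillow point is integrable in `t`, and moving to any other point costs at
most the Lipschitz constant times the diameter. The extra `1` ensures `1 ≤ q`, so that an absolute
error `δ` is also at most `δ * q`. -/
lemma exists_pcond_envelope (hB : M.Bounded) (hC : M.LipschitzIsotropic) :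
    ∃ q : Fin D → ℝ → ℝ, (∀ k, IntegrableOn (q k) (M.Z k)) ∧ (∀ k t, 1 ≤ q k t) ∧
      ∀ k, ∀ t ∈ M.Z k, ∀ u ∈ M.Zmp k, M.pcond k t u ≤ q k t := by
  obtain ⟨z, hz⟩ := M.exists_mem_box
  obtain ⟨R, hR0, hR⟩ := hB.exists_abs_le
  obtain ⟨A, hA0, hA⟩ := hC.exists_pcond_lipschitz
  refine ⟨fun k t => M.pcond k t (sub (M.mp k) z) + (A * (Fintype.card (M.mp k) * (2 * R)) + 1),
    fun k => ?_, fun k t => ?_, fun k t ht u hu => ?_⟩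
  · refine Integrable.add ?_ ?_
    · obtain ⟨ε, hε, h⟩ := hB.density k
      exact (integrableOn_jointDensity M.measurableSet_Z (M.mp k) k (M.notMem_mp k) _
        (hε.trans_le (h _ (M.sub_mem_Zmp hz k)))).div_const _
    · exact integrableOn_const (hB.compact k).measure_lt_top.ne
  · have h1 := pcond_nonneg (M := M) k t (sub (M.mp k) z)
    have h2 : 0 ≤ A * (Fintype.card (M.mp k) * (2 * R)) := by positivity
    linarith
  · have h1 := hA k t ht u hu _ (M.sub_mem_Zmp hz k)
    have h2 : dist u (sub (M.mp k) z) ≤ Fintype.card (M.mp k) * (2 * R) := by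
      refine dist_le_card_mul _ _ fun i => (abs_sub _ _).trans ?_
      have h3 := hR i _ (hu i)
      have h4 := hR i _ (M.sub_mem_Zmp hz k i)
      linarith
    have h3 := le_of_abs_le h1
    have h4 := mul_le_mul_of_nonneg_left h2 hA0
    linarith

lemma glue_extend_mem_box {j : Fin D} {x : EuclideanSpace ℝ (Finset.Iio j)}
    (hx : x ∈ box fun i : Finset.Iio j => M.Z i) {t : ℝ} (ht : t ∈ M.Z j)
    {y : EuclideanSpace ℝ ↥((Finset.Iic j)ᶜ)}
    (hy : y ∈ box fun i : ↥((Finset.Iic j)ᶜ) => M.Z i) :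
    glue (Finset.Iic j) (extend j x t) y ∈ box M.Z := by
  intro i
  by_cases h : i ∈ Finset.Iic j
  · by_cases h' : i < j
    · simpa [glue, extend, Finset.mem_Iic.1 h, h'] using hx ⟨i, Finset.mem_Iio.2 h'⟩
    · have : i = j := le_antisymm (Finset.mem_Iic.1 h) (not_lt.1 h')
      subst this
      simpa [glue, extend] using ht
  · simpa [glue, show ¬ i ≤ j from fun h' => h (Finset.mem_Iic.2 h')] using
      hy ⟨i, Finset.mem_compl.2 h⟩

lemma abs_glue_extend_sub_le (j : Fin D) (x : EuclideanSpace ℝ (Finset.Iio j)) (t t' : ℝ)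
    (y : EuclideanSpace ℝ ↥((Finset.Iic j)ᶜ)) (i : Fin D) :
    |glue (Finset.Iic j) (extend j x t) y i - glue (Finset.Iic j) (extend j x t') y i| ≤
      |t - t'| := by
  by_cases h : i ≤ j
  · by_cases h' : i < j <;> simp [glue, extend, h, h']
  · simp [glue, h]

/-- The integrand of `margLoss`. -/
def margIntegrand (M : Setup D F) (f : F) (j : Fin D) (x : EuclideanSpace ℝ (Finset.Iic j))
    (y : EuclideanSpace ℝ ↥((Finset.Iic j)ᶜ)) : ℝ :=
  M.loss f (glue (Finset.Iic j) x y) *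
    ∏ k ∈ Finset.Ioi j, M.pcond k (glue (Finset.Iic j) x y k)
      (sub (M.mp k) (glue (Finset.Iic j) x y))

lemma measurable_margIntegrand {f : F} (hf : Measurable (M.loss f)) (j : Fin D)
    (x : EuclideanSpace ℝ (Finset.Iic j)) : Measurable (M.margIntegrand f j x) := by
  have hg : Measurable (glue (Finset.Iic j) x) :=
    (measurable_glue (Finset.Iic j)).comp measurable_prodMk_left
  refine (hf.comp hg).mul (Finset.measurable_prod _ fun k _ => ?_)
  have h2 : Measurable fun y => glue (Finset.Iic j) x y k :=
    (by fun_prop : Measurable fun z : EuclideanSpace ℝ (Fin D) => z k).comp hg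
  exact (measurable_condDensity (Z := M.Z) M.measurable_p (M.mp k) k).comp
    (h2.prodMk ((measurable_sub _).comp hg))

/-- Changing `t` moves the loss by its Lipschitz bound and the product of conditional densities by
telescoping. Both changes are dominated by `|t - t'|` times the integrable product `Q` of envelopes.
-/
lemma exists_margLoss_bound (hB : M.Bounded) (hC : M.LipschitzIsotropic) (j : Fin D) :
    ∃ Λ : ℝ, 0 ≤ Λ ∧ ∀ g ∈ M.margLossClass j, ∀ t ∈ M.Z j, |g t| ≤ Λ ∧
      ∀ t' ∈ M.Z j, |g t - g t'| ≤ Λ * |t - t'| := by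
  obtain ⟨q, hqi, hq1, hq⟩ := exists_pcond_envelope hB hC
  obtain ⟨A, hA0, hA⟩ := hC.exists_pcond_lipschitz
  obtain ⟨ℓ, hℓ⟩ := hC.loss
  set B := M.lossBound.toReal with hBdef
  have hB0 : 0 ≤ B := ENNReal.toReal_nonneg
  set Q : EuclideanSpace ℝ ↥((Finset.Iic j)ᶜ) → ℝ := fun y =>
    ∏ i : ↥((Finset.Iic j)ᶜ), q i (y i) with hQ
  set bx := box fun i : ↥((Finset.Iic j)ᶜ) => M.Z i with hbx
  have hbxm : MeasurableSet bx := measurableSet_box fun i => M.measurableSet_Z i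
  have hQi : IntegrableOn Q bx :=
    integrableOn_box_prod (ι := ↥((Finset.Iic j)ᶜ)) (fun i => M.measurableSet_Z i) fun i => hqi i
  have hQ0 (y) : 0 ≤ Q y := Finset.prod_nonneg fun i _ => zero_le_one.trans (hq1 _ _)
  have hI0 : 0 ≤ ∫ y in bx, Q y := integral_nonneg hQ0
  have hQglue (x : EuclideanSpace ℝ (Finset.Iic j)) (y) :
      Q y = ∏ k ∈ Finset.Ioi j, q k (glue (Finset.Iic j) x y k) := by
    rw [Finset.prod_subtype (p := fun k => k ∈ (Finset.Iic j)ᶜ) (Finset.Ioi j) (by simp)]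
    refine Finset.prod_congr rfl fun i _ => ?_
    have : ¬ i.1 ≤ j := fun h => Finset.mem_compl.1 i.2 (Finset.mem_Iic.2 h)
    simp [glue, this]
  -- The first term comes from the loss; the second from at most `D` conditional densities, each
  -- Lipschitz in at most `D` pillow variables.
  set c := D * ℓ + B * (D * (A * D)) with hc
  have hc0 : 0 ≤ c := by positivity
  have hmeas (f : F) (x : EuclideanSpace ℝ (Finset.Iic j)) :
      AEStronglyMeasurable (M.margIntegrand f j x) (volume.restrict bx) :=
    (measurable_margIntegrand (hℓ f).continuous.measurable j x).aestronglyMeasurable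
  have hcardmp (k : Fin D) : (Fintype.card (M.mp k) : ℝ) ≤ D := by
    have := Finset.card_le_univ (M.mp k)
    simp only [Fintype.card_fin] at this
    rw [Fintype.card_coe]
    exact_mod_cast this
  refine ⟨B * (∫ y in bx, Q y) + c * ∫ y in bx, Q y, by positivity, ?_⟩
  rintro g ⟨f, x, hx, rfl⟩ t ht
  have hprod {s : ℝ} (hs : s ∈ M.Z j) {y} (hy : y ∈ bx) :
      ∏ k ∈ Finset.Ioi j, M.pcond k (glue (Finset.Iic j) (extend j x s) y k)
        (sub (M.mp k) (glue (Finset.Iic j) (extend j x s) y)) ≤ Q y := by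
    rw [hQglue (extend j x s)]
    have hz := glue_extend_mem_box hx hs hy
    exact Finset.prod_le_prod (fun k _ => pcond_nonneg _ _ _)
      fun k _ => hq k _ (hz k) _ (M.sub_mem_Zmp hz k)
  have hbound {s : ℝ} (hs : s ∈ M.Z j) :
      ∀ᵐ y ∂(volume.restrict bx), ‖M.margIntegrand f j (extend j x s) y‖ ≤ B * Q y := by
    filter_upwards [ae_restrict_mem hbxm] with y hy
    rw [Real.norm_eq_abs, margIntegrand, abs_mul,
      abs_of_nonneg (Finset.prod_nonneg fun k _ => pcond_nonneg _ _ _)]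
    exact mul_le_mul (hB.abs_loss_le _ _) (hprod hs hy)
      (Finset.prod_nonneg fun k _ => pcond_nonneg _ _ _) hB0
  have hint {s : ℝ} (hs : s ∈ M.Z j) :
      IntegrableOn (M.margIntegrand f j (extend j x s)) bx :=
    (hQi.const_mul B).mono' (hmeas _ _) (hbound hs)
  constructor
  · have h1 := norm_integral_le_of_norm_le (hQi.const_mul B) (hbound ht)
    rw [integral_const_mul, Real.norm_eq_abs] at h1
    have h2 : 0 ≤ c * ∫ y in bx, Q y := by positivity
    exact h1.trans (by linarith)
  · intro t' ht'
    have h1 : ∀ᵐ y ∂(volume.restrict bx), ‖M.margIntegrand f j (extend j x t) y -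
        M.margIntegrand f j (extend j x t') y‖ ≤ c * |t - t'| * Q y := by
      filter_upwards [ae_restrict_mem hbxm] with y hy
      have hz := glue_extend_mem_box hx ht hy
      have hz' := glue_extend_mem_box hx ht' hy
      have hd := abs_glue_extend_sub_le j x t t' y
      have hP' := hprod ht' hy
      have hP := hprod ht hy
      rw [Real.norm_eq_abs, margIntegrand, margIntegrand]
      have hQy := hQglue (extend j x t) y
      -- For `k > j` only the conditioning argument depends on `t`, and that is the argument in
      -- which the density is Lipschitz.
      have hsame : ∀ k ∈ Finset.Ioi j, glue (Finset.Iic j) (extend j x t') y k =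
          glue (Finset.Iic j) (extend j x t) y k := fun k hk => by
        have : ¬ k ≤ j := not_le.2 (Finset.mem_Ioi.1 hk)
        simp [glue, this]
      set z := glue (Finset.Iic j) (extend j x t) y
      set z' := glue (Finset.Iic j) (extend j x t') y
      set P := ∏ k ∈ Finset.Ioi j, M.pcond k (z k) (sub (M.mp k) z) with hPdef
      set P' := ∏ k ∈ Finset.Ioi j, M.pcond k (z' k) (sub (M.mp k) z') with hPdef'
      have hl : |M.loss f z - M.loss f z'| ≤ ℓ * (D * |t - t'|) := by
        rw [← Real.dist_eq]
        refine ((hℓ f).dist_le_mul z z').trans ?_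
        gcongr
        simpa using dist_le_card_mul z z' hd
      have hPP : |P - P'| ≤ D * (A * D * |t - t'|) * Q y := by
        have h3 : P' = ∏ k ∈ Finset.Ioi j, M.pcond k (z k) (sub (M.mp k) z') :=
          Finset.prod_congr rfl fun k hk => by rw [hsame k hk]
        rw [h3, hPdef, hQy]
        refine (abs_prod_sub_prod_le (δ := A * D * |t - t'|) (Finset.Ioi j) _ _
          (fun k => q k (z k)) (by positivity)
          (fun k _ => pcond_nonneg _ _ _) (fun k _ => pcond_nonneg _ _ _)
          (fun k _ => hq k _ (hz k) _ (M.sub_mem_Zmp hz k))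
          (fun k _ => hq k _ (hz k) _ (M.sub_mem_Zmp hz' k)) fun k _ => ?_).trans ?_
        · refine (hA k _ (hz k) _ (M.sub_mem_Zmp hz k) _ (M.sub_mem_Zmp hz' k)).trans ?_
          have h4 : dist (sub (M.mp k) z) (sub (M.mp k) z') ≤ D * |t - t'| :=
            (dist_le_card_mul (sub (M.mp k) z) (sub (M.mp k) z') fun i => hd i).trans
              (mul_le_mul_of_nonneg_right (hcardmp k) (abs_nonneg _))
          have h5 := mul_le_mul_of_nonneg_left h4 hA0
          have h6 : A * D * |t - t'| * 1 ≤ A * D * |t - t'| * q k (z k) :=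
            mul_le_mul_of_nonneg_left (hq1 _ _) (by positivity)
          linarith
        · have h4 : ((Finset.Ioi j).card : ℝ) ≤ D := by
            have := Finset.card_le_univ (Finset.Ioi j)
            simp only [Fintype.card_fin] at this
            exact_mod_cast this
          have h5 : 0 ≤ ∏ k ∈ Finset.Ioi j, q k (z k) :=
            Finset.prod_nonneg fun i _ => zero_le_one.trans (hq1 _ _)
          gcongr
      have hP0 : 0 ≤ P := Finset.prod_nonneg fun k _ => pcond_nonneg _ _ _
      have h7 : M.loss f z * P - M.loss f z' * P' =
          (M.loss f z - M.loss f z') * P + M.loss f z' * (P - P') := by ring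
      rw [h7]
      refine (abs_add_le _ _).trans ?_
      rw [abs_mul, abs_mul, abs_of_nonneg hP0]
      have h8 : |M.loss f z - M.loss f z'| * P ≤ ℓ * (D * |t - t'|) * Q y :=
        mul_le_mul hl hP hP0 (by positivity)
      have h9 : |M.loss f z'| * |P - P'| ≤ B * (D * (A * D * |t - t'|) * Q y) :=
        mul_le_mul (hB.abs_loss_le _ _) hPP (abs_nonneg _) hB0
      rw [hc]
      linarith
    have h2 := norm_integral_le_of_norm_le (hQi.const_mul (c * |t - t'|)) h1
    rw [integral_sub (hint ht) (hint ht'), integral_const_mul, Real.norm_eq_abs] at h2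
    have h3 : 0 ≤ B * (∫ y in bx, Q y) * |t - t'| := by positivity
    exact h2.trans (by linarith)

end Setup

/-! ### Discretization of the function classes -/

lemma exists_representatives {α ι : Type*} {X : Set α} (hX : X.Nonempty) (c : α → ι) :
    ∃ r : ι → α, (∀ i, r i ∈ X) ∧ ∀ x ∈ X, c (r (c x)) = c x := by
  have h (i : ι) : ∃ y ∈ X, (∃ x ∈ X, c x = i) → c y = i := by
    by_cases hi : ∃ x ∈ X, c x = i
    · obtain ⟨x, hx, hxi⟩ := hi
      exact ⟨x, hx, fun _ => hxi⟩
    · exact ⟨hX.some, hX.some_mem, fun h => absurd h hi⟩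
  choose r hr hc using h
  exact ⟨r, hr, fun x hx => hc _ ⟨x, hx, rfl⟩⟩

lemma natCast_le_exp (m : ℕ) : (m : ℝ) ≤ Real.exp m := by
  have := Real.add_one_le_exp (m : ℝ)
  linarith

lemma two_pow_le_exp (m : ℕ) : (2 : ℝ) ^ m ≤ Real.exp m := by
  have h : (2 : ℝ) ≤ Real.exp 1 := by
    have := Real.add_one_le_exp (1 : ℝ)
    linarith
  calc (2 : ℝ) ^ m ≤ Real.exp 1 ^ m := by gcongr
    _ = Real.exp m := by rw [← Real.exp_nat_mul, mul_one]

namespace Setup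

variable {D : ℕ} {F : Type*} {M : Setup D F}

lemma rademacher_lossClass_le (hB : M.Bounded) (hC : M.LipschitzIsotropic) :
    ∃ C : ℝ≥0, ∀ n : ℕ, 1 ≤ n →
      rademacher n M.law M.lossClass ≤ C * (n : ℝ≥0∞) ^ (-(1 / ((D : ℝ) + 2))) := by
  obtain ⟨R, hR0, hR⟩ := hB.exists_abs_le
  obtain ⟨ℓ, hℓ⟩ := hC.loss
  set B := M.lossBound.toReal + 1 with hBdef
  have hB0 : 0 < B := by positivity
  set E : ℝ := ℓ * (D * (4 * R)) with hE
  have hE0 : 0 ≤ E := by positivity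
  refine exists_rate_bound D (A := E + 2 * B) (by positivity) fun n hn m hm => ?_
  have hm' : (0 : ℝ) < m := by exact_mod_cast hm
  obtain ⟨c, hc⟩ := exists_quantizer hR0 hm
  obtain ⟨r, hr, hrc⟩ := exists_representatives M.exists_mem_box
    fun (z : EuclideanSpace ℝ (Fin D)) i => c (z i)
  -- Each loss is replaced by its value at the representative of the cell; the second factor is the
  -- single constant `B`.
  refine (rademacher_le_of_approx hn M.law M.ae_mem_box
    (fun (z : EuclideanSpace ℝ (Fin D)) i => c (z i)) (fun (_ : Unit) _ => B)
    (L := (m : ℝ) ^ D) (ε := E / m) hB0 (by positivity) (by positivity) ?_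
    (fun _ _ _ => (abs_of_pos hB0).le) ?_).trans (ENNReal.ofReal_le_ofReal ?_)
  · simpa using two_pow_le_exp (m ^ D)
  · rintro _ ⟨f, rfl⟩
    refine ⟨(), fun i => M.loss f (r i) / B, fun i => ?_, fun z hz => ?_⟩
    · rw [abs_div, abs_of_pos hB0, div_le_one hB0]
      exact (hB.abs_loss_le f _).trans (by linarith)
    · rw [div_mul_cancel₀ _ hB0.ne', ← Real.dist_eq]
      refine ((hℓ f).dist_le_mul _ _).trans ?_
      set w := r fun i => c (z i) with hw
      have h1 : dist z w ≤ D * (4 * R / m) := by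
        simpa using dist_le_card_mul z w fun i => hc _ _ (hR i _ (hz i)) (hR i _ (hr _ i))
          (congrFun (hrc z hz) i).symm
      calc ℓ * dist z w ≤ ℓ * (D * (4 * R / m)) := by gcongr
        _ = E / m := by rw [hE]; ring
  · have h1 : 0 ≤ B / m := by positivity
    have h2 : 0 ≤ E * √((m : ℝ) ^ D / n) := by positivity
    have h3 : (E + 2 * B) / m = E / m + 2 * (B / m) := by ring
    rw [h3, add_mul]
    linarith

lemma exists_KH_bound (hB : M.Bounded) (j : Fin D) :
    ∃ b : ℝ, 0 < b ∧ ∀ u, |M.KH j u| ≤ b := by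
  refine ⟨|(M.H j).det|⁻¹ * (⨆ u, ‖M.K j u‖ₑ).toReal + 1, by positivity, fun u => ?_⟩
  rw [KH, abs_mul, abs_inv, abs_abs]
  set v := (WithLp.toLp 2 (((M.H j)⁻¹).mulVec u.ofLp) : EuclideanSpace ℝ (M.mp j))
  have h1 : |M.K j v| ≤ (⨆ u, ‖M.K j u‖ₑ).toReal := by
    rw [← Real.norm_eq_abs, ← toReal_enorm]
    exact ENNReal.toReal_mono (hB.kernel j).ne (le_iSup (fun u => ‖M.K j u‖ₑ) v)
  have h2 : |(M.H j).det|⁻¹ * |M.K j v| ≤ |(M.H j).det|⁻¹ * (⨆ u, ‖M.K j u‖ₑ).toReal := by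
    gcongr
  linarith

lemma exists_KH_lipschitz (hC : M.LipschitzIsotropic) (j : Fin D) :
    ∃ κ : ℝ, 0 ≤ κ ∧ ∀ u v, |M.KH j u - M.KH j v| ≤ κ * dist u v := by
  obtain ⟨C, hK⟩ := hC.kernel j
  set T := LinearMap.toContinuousLinearMap (Matrix.toEuclideanLin (M.H j)⁻¹) with hT
  refine ⟨|(M.H j).det|⁻¹ * (C * ‖T‖), by positivity, fun u v => ?_⟩
  have h1 (u) : M.KH j u = |(M.H j).det|⁻¹ * M.K j (T u) := rfl
  rw [h1, h1, ← mul_sub, abs_mul, abs_inv, abs_abs, mul_assoc, ← Real.dist_eq]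
  refine mul_le_mul_of_nonneg_left ((hK.dist_le_mul _ _).trans ?_) (by positivity)
  rw [mul_assoc]
  exact mul_le_mul_of_nonneg_left (T.lipschitz.dist_le_mul u v) C.2

/-- Products of functions of the `j`-th variable that are bounded and Lipschitz on its range, and
shifted kernels of the variables in the Markov pillow of `j`. -/
lemma rademacher_mul_kernel_le (hB : M.Bounded) (hC : M.LipschitzIsotropic) (j : Fin D)
    {𝓕 : Set (EuclideanSpace ℝ (Fin D) → ℝ)} {Λ : ℝ} (hΛ : 0 < Λ)
    (hF : ∀ φ ∈ 𝓕, ∃ g : ℝ → ℝ, ∃ u ∈ M.Zmp j,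
      (∀ t ∈ M.Z j, |g t| ≤ Λ ∧ ∀ t' ∈ M.Z j, |g t - g t'| ≤ Λ * |t - t'|) ∧
      φ = fun z => g (z j) * M.KH j (u - sub (M.mp j) z)) :
    ∃ C : ℝ≥0, ∀ n : ℕ, 1 ≤ n →
      rademacher n M.law 𝓕 ≤ C * (n : ℝ≥0∞) ^ (-(1 / 3 : ℝ)) := by
  obtain ⟨R, hR0, hR⟩ := hB.exists_abs_le
  obtain ⟨b, hb0, hb⟩ := exists_KH_bound hB j
  obtain ⟨κ, hκ0, hκ⟩ := exists_KH_lipschitz hC j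
  obtain ⟨z₀, hz₀⟩ := M.exists_mem_box
  set d := Fintype.card (M.mp j) with hd
  set E : ℝ := Λ * (4 * R) * b + Λ * (κ * (d * (4 * R))) with hE
  have hE0 : 0 ≤ E := by positivity
  -- Effective dimension `1`: the pillow size `d` enters only the constant.
  have key := exists_rate_bound 1 (A := E + 2 * (Λ * b) * √(1 + d)) (by positivity)
    (r := fun n => rademacher n M.law 𝓕) fun n hn m hm => ?_
  · have h3 : ((1 : ℕ) : ℝ) + 2 = 3 := by norm_num
    rwa [h3] at key
  have hm' : (0 : ℝ) < m := by exact_mod_cast hm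
  obtain ⟨c, hc⟩ := exists_quantizer hR0 hm
  obtain ⟨r, hr, hrc⟩ := exists_representatives ⟨_, hz₀ j⟩ c
  obtain ⟨s, hs, hsc⟩ := exists_representatives (X := M.Zmp j) ⟨_, M.sub_mem_Zmp hz₀ j⟩
    fun (u : EuclideanSpace ℝ (M.mp j)) i => c (u i)
  have : Nonempty (Fin m) := ⟨⟨0, hm⟩⟩
  -- Only coordinate `j` of the data is quantized. For the kernel it is the shift `u` that is
  -- rounded, with `m ^ d` choices, and the kernel stays exact in `z`.
  refine (rademacher_le_of_approx hn M.law M.ae_mem_box (fun z => c (z j))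
    (fun (i : M.mp j → Fin m) z => Λ * M.KH j (s i - sub (M.mp j) z))
    (b := Λ * b) (L := (1 + d) * m) (ε := E / m) (by positivity) (by positivity)
    (by positivity) ?_ (fun i z _ => ?_) ?_).trans (ENNReal.ofReal_le_ofReal ?_)
  · have h1 : (m : ℝ) ^ d ≤ Real.exp (d * m) := by
      rw [Real.exp_nat_mul]
      gcongr
      exact natCast_le_exp m
    rw [add_mul, one_mul, Real.exp_add, Fintype.card_fin, Fintype.card_fun, Fintype.card_fin]
    push_cast
    exact mul_le_mul (two_pow_le_exp m) h1 (by positivity) (by positivity)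
  · rw [abs_mul, abs_of_pos hΛ]
    exact mul_le_mul_of_nonneg_left (hb _) hΛ.le
  · intro φ hφ
    obtain ⟨g, u, hu, hg, rfl⟩ := hF φ hφ
    refine ⟨fun i => c (u i), fun i => g (r i) / Λ, fun i => ?_, fun z hz => ?_⟩
    · rw [abs_div, abs_of_pos hΛ, div_le_one hΛ]
      exact (hg _ (hr i)).1
    · set t := r (c (z j)) with ht
      set v := s fun i => c (u i) with hv
      set y := sub (M.mp j) z
      have h1 : g (z j) * M.KH j (u - y) - g t / Λ * (Λ * M.KH j (v - y)) =
          (g (z j) - g t) * M.KH j (u - y) + g t * (M.KH j (u - y) - M.KH j (v - y)) := by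
        field_simp
        ring
      have h2 : |z j - t| ≤ 4 * R / m :=
        hc _ _ (hR j _ (hz j)) (hR j _ (hr _)) (hrc _ (hz j)).symm
      have h3 : dist u v ≤ d * (4 * R / m) :=
        dist_le_card_mul u v fun i => hc _ _ (hR i _ (hu i)) (hR i _ (hs _ i))
          (congrFun (hsc u hu) i).symm
      have h4 : |g (z j) - g t| ≤ Λ * (4 * R / m) :=
        ((hg _ (hz j)).2 _ (hr _)).trans (mul_le_mul_of_nonneg_left h2 hΛ.le)
      have h5 : |M.KH j (u - y) - M.KH j (v - y)| ≤ κ * (d * (4 * R / m)) := by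
        refine (hκ _ _).trans ?_
        rw [dist_sub_right]
        exact mul_le_mul_of_nonneg_left h3 hκ0
      rw [h1]
      calc |(g (z j) - g t) * M.KH j (u - y) + g t * (M.KH j (u - y) - M.KH j (v - y))|
          ≤ |g (z j) - g t| * |M.KH j (u - y)| +
              |g t| * |M.KH j (u - y) - M.KH j (v - y)| := by
            rw [← abs_mul, ← abs_mul]
            exact abs_add_le _ _
        _ ≤ Λ * (4 * R / m) * b + Λ * (κ * (d * (4 * R / m))) := by
            gcongr
            · exact hb _
            · exact (hg _ (hr _)).1
        _ = E / m := by rw [hE]; ring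
  · have h1 : √((1 + d) * m / n) = √(1 + d) * √((m : ℝ) ^ 1 / n) := by
      rw [pow_one, ← Real.sqrt_mul (by positivity), mul_div_assoc]
    have h2 : 0 ≤ 2 * (Λ * b) * √(1 + d) / m := by positivity
    have h3 : 0 ≤ E * √((m : ℝ) ^ 1 / n) := by positivity
    rw [h1, add_div E, add_mul]
    linarith

lemma rademacher_productClass_le (hB : M.Bounded) (hC : M.LipschitzIsotropic) (j : Fin D) :
    ∃ C : ℝ≥0, ∀ n : ℕ, 1 ≤ n →
      rademacher n M.law (M.productClass j) ≤ C * (n : ℝ≥0∞) ^ (-(1 / 3 : ℝ)) := by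
  obtain ⟨Λ, hΛ0, hΛ⟩ := exists_margLoss_bound hB hC j
  refine rademacher_mul_kernel_le hB hC j (Λ := Λ + 1) (by positivity) ?_
  rintro _ ⟨g, hg, _, ⟨u, hu, rfl⟩, rfl⟩
  refine ⟨g, u, hu, fun t ht => ⟨(hΛ g hg t ht).1.trans (by linarith), fun t' ht' => ?_⟩, rfl⟩
  refine ((hΛ g hg t ht).2 t' ht').trans ?_
  gcongr
  linarith

lemma rademacher_liftedKernelClass_le (hB : M.Bounded) (hC : M.LipschitzIsotropic)
    (j : Fin D) : ∃ C : ℝ≥0, ∀ n : ℕ, 1 ≤ n →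
      rademacher n M.law (M.liftedKernelClass j) ≤ C * (n : ℝ≥0∞) ^ (-(1 / 3 : ℝ)) := by
  refine rademacher_mul_kernel_le hB hC j one_pos ?_
  rintro _ ⟨_, ⟨u, hu, rfl⟩, rfl⟩
  exact ⟨fun _ => 1, u, hu, fun t _ => ⟨by simp, fun t' _ => by simp⟩, by simp⟩

lemma sum_ofReal_mul_le {ι : Type*} [Fintype ι] (w : ι → ℝ) {r : ι → ℕ → ℝ≥0∞}
    {e : ℕ → ℝ≥0∞} (hr : ∀ i, ∃ C : ℝ≥0, ∀ n : ℕ, 1 ≤ n → r i n ≤ C * e n) :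
    ∃ C : ℝ≥0, ∀ n : ℕ, 1 ≤ n → ∑ i, ENNReal.ofReal (w i) * r i n ≤ C * e n := by
  choose C hC using hr
  refine ⟨∑ i, (w i).toNNReal * C i, fun n hn => ?_⟩
  push_cast
  rw [Finset.sum_mul]
  refine Finset.sum_le_sum fun i _ => ?_
  rw [mul_assoc]
  exact mul_le_mul_right (hC i n hn) _

end Setup

end ADMGAug

end

theorem mainTheorem2 {D : ℕ} {F : Type*} (M : ADMGAug.Setup D F) (β L : ℝ) (hβ : 1 < β)
    (hL : 0 < L) (hB : M.Bounded) (hS : M.Smooth β L) (hC : M.LipschitzIsotropic) :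
    (∃ C : ℝ≥0, ∀ n : ℕ, 1 ≤ n →
      ADMGAug.rademacher n M.law M.lossClass ≤ C * (n : ℝ≥0∞) ^ (-(1 / ((D : ℝ) + 2)))) ∧
    (∃ C : ℝ≥0, ∀ n : ℕ, 1 ≤ n →
      M.hypothesisComplexity n + M.lossBound * M.kernelComplexity n ≤
        C * (n : ℝ≥0∞) ^ (-(1 / 3 : ℝ))) := by
  refine ⟨M.rademacher_lossClass_le hB hC, ?_⟩
  obtain ⟨C₁, h₁⟩ := ADMGAug.Setup.sum_ofReal_mul_le (fun j => |(M.H j).det|)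
    fun j => M.rademacher_productClass_le hB hC j
  obtain ⟨C₂, h₂⟩ := ADMGAug.Setup.sum_ofReal_mul_le (fun j => |(M.H j).det|)
    fun j => M.rademacher_liftedKernelClass_le hB hC j
  refine ⟨C₁ + M.lossBound.toNNReal * C₂, fun n hn => ?_⟩
  push_cast
  rw [ENNReal.coe_toNNReal hB.loss.ne, add_mul, mul_assoc]
  exact add_le_add (h₁ n hn) (mul_le_mul_right (h₂ n hn) _)
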